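/- Let $(\mathcal X,d)$ be a proper (closed balls are compact) Polish metric space, let $\mathcal Y=\{1,\dots,K\}$ with the discrete metric, and write $\mathcal M_+^1(\mathcal Z)$ for the set of Borel probability measures on $\mathcal Z$. Let $\mathbb P\in\mathcal M_+^1(\mathcal X\times\mathcal Y)$ and $\varepsilon>0$. Write $\Pi_1,\Pi_2:(\mathcal X\times\mathcal Y)^2\to\mathcal X\times\mathcal Y$ for the two projections, and for $\mathbb Q\in\mathcal M_+^1(\mathcal X\times\mathcal Y)$ let $$\Gamma_{\mathbb P,\mathbb Q}:=\{\gamma\in\mathcal M_+^1((\mathcal X\times\mathcal Y)^2)\mid \Pi_{1\sharp}\gamma=\mathbb P,\ \Pi_{2\sharp}\gamma=\mathbb Q\}.$$ Define the set of adversarial distributions $$\mathcal A_\varepsilon(\mathbb P):=\{\mathbb Q\in\mathcal M_+^1(\mathcal X\times\mathcal Y)\mid \exists\gamma\in\Gamma_{\mathbb P,\mathbb Q}:\ d(x,x')\le\varepsilon \text{ and } y=y' \text{ for } \gamma\text{-almost every } ((x,y),(x',y'))\},$$ the cost $c_\varepsilon((x,y),(x',y')):=0$ if $d(x,x')\le\varepsilon$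 and $y=y'$, and $:=+\infty$ otherwise, the optimal transport value $W_{c_\varepsilon}(\mathbb P,\mathbb Q):=\inf_{\gamma\in\Gamma_{\mathbb P,\mathbb Q}}\int c_\varepsilon\,d\gamma$, and, for $0\le\eta<\infty$, the Wasserstein ball $$\mathcal B_{c_\varepsilon}(\mathbb P,\eta):=\{\mathbb Q\in\mathcal M_+^1(\mathcal X\times\mathcal Y)\mid W_{c_\varepsilon}(\mathbb P,\mathbb Q)\le\eta\}.$$ Then $\mathcal B_{c_\varepsilon}(\mathbb P,\eta)=\mathcal A_\varepsilon(\mathbb P)$ for every real $\eta\ge 0$. Moreover, $\mathcal A_\varepsilon(\mathbb P)$ is convex, and it is compact for the weak topology of $\mathcal M_+^1(\mathcal X\times\mathcal Y)$ (the topology of convergence of integrals of bounded continuous functions). -/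

import Mathlib

open MeasureTheory
open scoped NNReal ENNReal

namespace AdversarialGame

section OptimalTransport

variable {Z : Type*} [MeasurableSpace Z]

/-- The set `Γ_{P,Q}` of couplings of `P` and `Q`: probability measures on `Z × Z` whose first
marginal is `P` and whose second marginal is `Q`. -/
def couplings (P Q : ProbabilityMeasure Z) : Set (ProbabilityMeasure (Z × Z)) :=
  {γ | (γ : Measure (Z × Z)).map Prod.fst = (P : Measure Z) ∧
    (γ : Measure (Z × Z)).map Prod.snd = (Q : Measure Z)}

/-- The optimal transport value `W_c(P, Q) = inf_{γ ∈ Γ_{P,Q}} ∫ c(z, z') dγ(z, z')` for a cost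
with values in `[0, ∞]`. -/
noncomputable def transportCost (c : Z → Z → ℝ≥0∞) (P Q : ProbabilityMeasure Z) : ℝ≥0∞ :=
  ⨅ γ ∈ couplings P Q, ∫⁻ z, c z.1 z.2 ∂(γ : Measure (Z × Z))

/-- The Wasserstein uncertainty set `B_c(P, η) = {Q | W_c(P, Q) ≤ η}`, for a finite radius `η`. -/
def wassersteinBall (c : Z → Z → ℝ≥0∞) (P : ProbabilityMeasure Z) (η : ℝ≥0) :
    Set (ProbabilityMeasure Z) :=
  {Q | transportCost c P Q ≤ (η : ℝ≥0∞)}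

end OptimalTransport

section Adversarial

variable {X Y : Type*} [MetricSpace X]

open Classical in
/-- The cost `c_ε`: it is `0` if `d(x, x') ≤ ε` and `y = y'`, and `+∞` otherwise. -/
noncomputable def advCost (ε : ℝ) (z z' : X × Y) : ℝ≥0∞ :=
  if dist z.1 z'.1 ≤ ε ∧ z.2 = z'.2 then 0 else ∞

/-- The set `A_ε(P)` of adversarial distributions: the laws `Q` for which some probability measure
`γ` on `(X × Y)²` has marginals `P` and `Q` and satisfies `d(x, x') ≤ ε` and `y = y'` almost
surely. -/
def advSet [MeasurableSpace X] [MeasurableSpace Y] (ε : ℝ) (P : ProbabilityMeasure (X × Y)) :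
    Set (ProbabilityMeasure (X × Y)) :=
  {Q | ∃ γ : ProbabilityMeasure ((X × Y) × (X × Y)),
    (∀ᵐ z ∂(γ : Measure ((X × Y) × (X × Y))), dist z.1.1 z.2.1 ≤ ε ∧ z.1.2 = z.2.2) ∧
    (γ : Measure ((X × Y) × (X × Y))).map Prod.fst = (P : Measure (X × Y)) ∧
    (γ : Measure ((X × Y) × (X × Y))).map Prod.snd = (Q : Measure (X × Y))}

end Adversarial

end AdversarialGame

/-!
Since `c_ε` takes only the values `0` and `∞`, a coupling of finite cost is concentrated on the
relation `{c_ε = 0}` and has cost `0`, so the radius of the ball is irrelevant. The couplings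
concentrated on this relation with first marginal `P` are cut out by linear conditions, hence
convex. The relation is closed, and above a compact set of source points it is compact because
balls of `X` are; so these couplings form a closed set and inherit tightness from `P`, and they are
compact by Prokhorov's theorem. Both properties pass to the image under the second marginal.
-/

namespace AdversarialGame

section FixedPushforward

variable {E F : Type*} [MeasurableSpace E] [MeasurableSpace F]

lemma convex_setOf_ae_mem (R : Set E) : Convex ℝ≥0 {μ : Measure E | ∀ᵐ z ∂μ, z ∈ R} :=
  fun _ hμ _ hν a b _ _ _ ↦
    ae_add_measure_iff.2 ⟨Measure.ae_smul_measure hμ a, Measure.ae_smul_measure hν b⟩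

lemma isLinearMap_map {f : E → F} (hf : Measurable f) :
    IsLinearMap ℝ≥0 (Measure.map f : Measure E → Measure F) where
  map_add μ ν := Measure.map_add μ ν hf
  map_smul c μ := Measure.map_smul c μ f

lemma convex_setOf_ae_mem_and_map_eq {f : E → F} (hf : Measurable f) (R : Set E) (ν : Measure F) :
    Convex ℝ≥0 {μ : Measure E | (∀ᵐ z ∂μ, z ∈ R) ∧ μ.map f = ν} :=
  (convex_setOf_ae_mem R).inter ((convex_singleton ν).is_linear_preimage (isLinearMap_map hf))

variable [TopologicalSpace E] [TopologicalSpace F]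

lemma isClosed_setOf_ae_mem [OpensMeasurableSpace E] [HasOuterApproxClosed E] {R : Set E}
    (hR : IsClosed R) : IsClosed {μ : ProbabilityMeasure E | ∀ᵐ z ∂(μ : Measure E), z ∈ R} := by
  refine isClosed_iff_forall_filter.2 fun μ L _ hL hμ ↦ ?_
  have h_open : (μ : Measure E) Rᶜ ≤
      L.liminf fun ν : ProbabilityMeasure E ↦ (ν : Measure E) Rᶜ :=
    ProbabilityMeasure.le_liminf_measure_open_of_tendsto hμ hR.isOpen_compl
  have h_zero : (fun ν : ProbabilityMeasure E ↦ (ν : Measure E) Rᶜ) =ᶠ[L] fun _ ↦ 0 :=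
    hL fun _ hν ↦ hν
  rw [Filter.liminf_congr h_zero, Filter.liminf_const] at h_open
  exact le_antisymm h_open zero_le

lemma isClosed_setOf_map_eq [OpensMeasurableSpace E] [BorelSpace F] [HasOuterApproxClosed F]
    {f : E → F} (hf : Continuous f) (P : ProbabilityMeasure F) :
    IsClosed {μ : ProbabilityMeasure E | (μ : Measure E).map f = P} := by
  simp only [← ProbabilityMeasure.toMeasure_map _ hf.aemeasurable,
    ProbabilityMeasure.toMeasure_injective.eq_iff]
  exact isClosed_singleton.preimage (ProbabilityMeasure.continuous_map hf)

lemma isTightMeasureSet_of_image_map {f : E → F} (hf : Measurable f) {R : Set E}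
    (hfR : ∀ K, IsCompact K → IsCompact (R ∩ f ⁻¹' K)) {S : Set (Measure E)}
    (hSR : ∀ μ ∈ S, ∀ᵐ z ∂μ, z ∈ R) (hS : IsTightMeasureSet (Measure.map f '' S)) :
    IsTightMeasureSet S := by
  rw [isTightMeasureSet_iff_exists_isCompact_measure_compl_le] at hS ⊢
  intro δ hδ
  obtain ⟨K, hK, hKδ⟩ := hS δ hδ
  refine ⟨R ∩ f ⁻¹' K, hfR K hK, fun μ hμ ↦ ?_⟩
  calc μ (R ∩ f ⁻¹' K)ᶜ ≤ μ (f ⁻¹' Kᶜ) :=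
        measure_mono_ae ((hSR μ hμ).mono fun _ hzR hz hzK ↦ hz ⟨hzR, hzK⟩)
    _ ≤ μ.map f Kᶜ := Measure.le_map_apply hf.aemeasurable _
    _ ≤ δ := hKδ _ (Set.mem_image_of_mem _ hμ)

lemma isCompact_setOf_ae_mem_and_map_eq [T2Space E] [BorelSpace E] [HasOuterApproxClosed E]
    [PolishSpace F] [BorelSpace F] {f : E → F} (hf : Continuous f) {R : Set E} (hR : IsClosed R)
    (hfR : ∀ K, IsCompact K → IsCompact (R ∩ f ⁻¹' K)) (P : ProbabilityMeasure F) :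
    IsCompact {μ : ProbabilityMeasure E |
      (∀ᵐ z ∂(μ : Measure E), z ∈ R) ∧ (μ : Measure E).map f = P} := by
  have h_closed : IsClosed {μ : ProbabilityMeasure E |
      (∀ᵐ z ∂(μ : Measure E), z ∈ R) ∧ (μ : Measure E).map f = P} :=
    (isClosed_setOf_ae_mem hR).inter (isClosed_setOf_map_eq hf P)
  rw [← h_closed.closure_eq]
  refine isCompact_closure_of_isTightMeasureSet
    (isTightMeasureSet_of_image_map hf.measurable hfR ?_ ?_)
  · rintro _ ⟨μ, hμ, rfl⟩
    exact hμ.1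
  · refine (isTightMeasureSet_singleton (μ := (P : Measure F))).subset ?_
    rintro _ ⟨_, ⟨μ, hμ, rfl⟩, rfl⟩
    exact hμ.2

end FixedPushforward

section Transport

variable {Z W : Type*} [MeasurableSpace Z] [MeasurableSpace W]

/-- The laws on `W` to which `P` can be transported along the relation `R`: the second marginals of
the probability measures on `Z × W` that are concentrated on `R` and have first marginal `P`. -/
def transportSet (R : Set (Z × W)) (P : ProbabilityMeasure Z) : Set (ProbabilityMeasure W) :=
  {Q | ∃ γ : ProbabilityMeasure (Z × W), (∀ᵐ z ∂(γ : Measure (Z × W)), z ∈ R) ∧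
    (γ : Measure (Z × W)).map Prod.fst = P ∧ (γ : Measure (Z × W)).map Prod.snd = Q}

lemma wassersteinBall_indicator_top {R : Set (Z × Z)} (hR : MeasurableSet R)
    (P : ProbabilityMeasure Z) (η : ℝ≥0) :
    wassersteinBall (fun z z' ↦ Rᶜ.indicator (fun _ ↦ ∞) (z, z')) P η = transportSet R P := by
  have h_cost (γ : ProbabilityMeasure (Z × Z)) :
      ∫⁻ z, Rᶜ.indicator (fun _ ↦ ∞) (z.1, z.2) ∂(γ : Measure (Z × Z)) =
        ∞ * (γ : Measure (Z × Z)) Rᶜ :=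
    lintegral_indicator_const hR.compl ∞
  ext Q
  simp only [wassersteinBall, transportCost, h_cost, Set.mem_ofPred_eq]
  constructor
  · intro hQ
    obtain ⟨γ, ⟨hP, hQ⟩, h_fin⟩ : ∃ γ ∈ couplings P Q, ∞ * (γ : Measure (Z × Z)) Rᶜ < ∞ := by
      simpa only [iInf_lt_iff, exists_prop] using hQ.trans_lt ENNReal.coe_lt_top
    exact ⟨γ, by_contra fun h ↦ h_fin.ne (ENNReal.top_mul h), hP, hQ⟩
  · rintro ⟨γ, hγ, h_marginals⟩
    have h_null : (γ : Measure (Z × Z)) Rᶜ = 0 := hγ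
    calc ⨅ γ ∈ couplings P Q, ∞ * (γ : Measure (Z × Z)) Rᶜ
        ≤ ∞ * (γ : Measure (Z × Z)) Rᶜ := iInf₂_le γ h_marginals
      _ = 0 := by rw [h_null, mul_zero]
      _ ≤ η := zero_le

lemma image_toMeasure_transportSet (R : Set (Z × W)) (P : ProbabilityMeasure Z) :
    (fun Q : ProbabilityMeasure W ↦ (Q : Measure W)) '' transportSet R P =
      Measure.map Prod.snd '' {γ : Measure (Z × W) | (∀ᵐ z ∂γ, z ∈ R) ∧ γ.map Prod.fst = P} := by
  ext ν
  constructor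
  · rintro ⟨Q, ⟨γ, hR, hP, hQ⟩, rfl⟩
    exact ⟨γ, ⟨hR, hP⟩, hQ⟩
  · rintro ⟨γ, ⟨hR, hP⟩, rfl⟩
    have : IsProbabilityMeasure (γ.map Prod.fst) := hP ▸ inferInstance
    have : IsProbabilityMeasure γ := Measure.isProbabilityMeasure_of_map Prod.fst
    exact ⟨⟨γ.map Prod.snd, Measure.isProbabilityMeasure_map measurable_snd.aemeasurable⟩,
      ⟨⟨γ, this⟩, hR, hP, rfl⟩, rfl⟩

lemma convex_transportSet (R : Set (Z × W)) (P : ProbabilityMeasure Z) :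
    Convex ℝ≥0 ((fun Q : ProbabilityMeasure W ↦ (Q : Measure W)) '' transportSet R P) := by
  rw [image_toMeasure_transportSet]
  exact (convex_setOf_ae_mem_and_map_eq measurable_fst R P).is_linear_image
    (isLinearMap_map measurable_snd)

lemma transportSet_eq_image_map_snd (R : Set (Z × W)) (P : ProbabilityMeasure Z) :
    transportSet R P =
      (fun γ : ProbabilityMeasure (Z × W) ↦ γ.map measurable_snd.aemeasurable) ''
        {γ | (∀ᵐ z ∂(γ : Measure (Z × W)), z ∈ R) ∧ (γ : Measure (Z × W)).map Prod.fst = P} := by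
  ext Q
  simp only [transportSet, Set.mem_ofPred_eq, Set.mem_image, and_assoc,
    ← ProbabilityMeasure.toMeasure_injective.eq_iff, ProbabilityMeasure.toMeasure_map]

lemma isCompact_transportSet [TopologicalSpace Z] [PolishSpace Z] [BorelSpace Z]
    [TopologicalSpace W] [PolishSpace W] [BorelSpace W] {R : Set (Z × W)} (hR : IsClosed R)
    (hR_compact : ∀ K, IsCompact K → IsCompact (R ∩ Prod.fst ⁻¹' K)) (P : ProbabilityMeasure Z) :
    IsCompact (transportSet R P) := by
  rw [transportSet_eq_image_map_snd]
  exact (isCompact_setOf_ae_mem_and_map_eq continuous_fst hR hR_compact P).image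
    (ProbabilityMeasure.continuous_map continuous_snd)

end Transport

section AdversarialRelation

variable {X Y : Type*} [MetricSpace X]

variable (X Y) in
/-- The zero set of the cost `c_ε`: the pairs of labelled points at distance at most `ε` with equal
labels. -/
def advRel (ε : ℝ) : Set ((X × Y) × (X × Y)) :=
  {z | dist z.1.1 z.2.1 ≤ ε ∧ z.1.2 = z.2.2}

lemma advCost_eq_indicator_compl_advRel (ε : ℝ) :
    (advCost ε : X × Y → X × Y → ℝ≥0∞) =
      fun z z' ↦ (advRel X Y ε)ᶜ.indicator (fun _ ↦ ∞) (z, z') := by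
  classical
  ext z z'
  simp only [advCost, advRel, Set.indicator_apply, Set.mem_compl_iff, Set.mem_ofPred_eq, ite_not]

lemma advSet_eq_transportSet [MeasurableSpace X] [MeasurableSpace Y] (ε : ℝ)
    (P : ProbabilityMeasure (X × Y)) : advSet ε P = transportSet (advRel X Y ε) P := rfl

variable [TopologicalSpace Y] [T2Space Y]

lemma isClosed_advRel (ε : ℝ) : IsClosed (advRel X Y ε) := by
  have h_dist : IsClosed {z : (X × Y) × (X × Y) | dist z.1.1 z.2.1 ≤ ε} :=
    isClosed_le (by fun_prop) continuous_const
  have h_label : IsClosed {z : (X × Y) × (X × Y) | z.1.2 = z.2.2} :=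
    isClosed_eq (by fun_prop) (by fun_prop)
  exact h_dist.inter h_label

lemma isCompact_advRel_inter_preimage_fst [ProperSpace X] (ε : ℝ) {K : Set (X × Y)}
    (hK : IsCompact K) : IsCompact (advRel X Y ε ∩ Prod.fst ⁻¹' K) := by
  have h_box : IsCompact (K ×ˢ (Metric.cthickening ε (Prod.fst '' K) ×ˢ (Prod.snd '' K))) :=
    hK.prod ((hK.image continuous_fst).cthickening.prod (hK.image continuous_snd))
  refine h_box.of_isClosed_subset
    ((isClosed_advRel ε).inter (hK.isClosed.preimage continuous_fst)) ?_
  rintro ⟨⟨x, y⟩, ⟨x', y'⟩⟩ ⟨⟨h_dist, rfl : y = y'⟩, hz : (x, y) ∈ K⟩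
  exact ⟨hz, Metric.mem_cthickening_of_dist_le x' x ε _ (Set.mem_image_of_mem _ hz)
    (dist_comm x x' ▸ h_dist), ⟨_, hz, rfl⟩⟩

end AdversarialRelation

end AdversarialGame

open AdversarialGame in
theorem mainTheorem3_general {X Y : Type*} [MetricSpace X] [ProperSpace X] [MeasurableSpace X]
    [BorelSpace X] [TopologicalSpace Y] [PolishSpace Y] [MeasurableSpace Y] [BorelSpace Y]
    (P : ProbabilityMeasure (X × Y)) (ε : ℝ) :
    (∀ η : ℝ≥0, wassersteinBall (advCost ε) P η = advSet ε P) ∧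
    Convex ℝ≥0 ((fun Q : ProbabilityMeasure (X × Y) ↦ (Q : Measure (X × Y))) '' advSet ε P) ∧
    IsCompact (advSet ε P) := by
  rw [advCost_eq_indicator_compl_advRel, advSet_eq_transportSet]
  exact ⟨wassersteinBall_indicator_top (isClosed_advRel ε).measurableSet P,
    convex_transportSet _ P,
    isCompact_transportSet (isClosed_advRel ε)
      (fun _ ↦ isCompact_advRel_inter_preimage_fst ε) P⟩

/-- `X` is a proper metric space (hence complete and separable) with its Borel `σ`-algebra, and the
label set `{1, …, K}` is `Fin K` with its discrete topology and `σ`-algebra. The topology on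
`ProbabilityMeasure (X × Fin K)` is that of weak convergence. Convexity is that of the set of
underlying measures: `a • Q₁ + b • Q₂` stays in the set for all `a, b ≥ 0` with `a + b = 1`. -/
theorem mainTheorem3 {X : Type*} [MetricSpace X] [ProperSpace X] [MeasurableSpace X] [BorelSpace X]
    (K : ℕ) (P : ProbabilityMeasure (X × Fin K)) (ε : ℝ) (hε : 0 < ε) :
    (∀ η : ℝ≥0, AdversarialGame.wassersteinBall (AdversarialGame.advCost ε) P η
      = AdversarialGame.advSet ε P) ∧
    Convex ℝ≥0 ((fun Q : ProbabilityMeasure (X × Fin K) => (Q : Measure (X × Fin K))) ''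
      AdversarialGame.advSet ε P) ∧
    IsCompact (AdversarialGame.advSet ε P) :=
  mainTheorem3_general P ε
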